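/- Let $H$ be a separable complex Hilbert space and let $\mathcal{B}(H)$ be the $C^*$-algebra of all bounded linear operators on $H$. Let $\phi:\mathcal{B}(H)\to\mathcal{B}(H)$ be a map (not assumed to be linear) with the following property: for any $A,B\in\mathcal{B}(H)$ there exists a $*$-automorphism $\phi_{A,B}$ of $\mathcal{B}(H)$, possibly depending on $A$ and $B$, such that $$\phi(A)\phi(B)=\phi_{A,B}(AB).$$ Then $\phi$ is either a $*$-automorphism of $\mathcal{B}(H)$ or the negative of a $*$-automorphism of $\mathcal{B}(H)$. -/

import Mathlib

open InnerProductSpace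

/-! ### Rank-one operators and Hilbert bases. -/

section

variable {H : Type*} [NormedAddCommGroup H] [InnerProductSpace ℂ H]

/-! Automorphisms of `B(H)` are unitary conjugations, so products of values of `φ` keep traces of
rank-one products. A projection `a ⊗ a`, with `a` a unit vector having no zero coordinate in a basis
`e`, goes to `± b ⊗ b`; replacing `φ` by `-φ` makes the sign `+`. Comparison with `a ⊗ a` then
forces `φ (e i ⊗ e i) = x i ⊗ x i` and fixes the phases of the `x i` (`exists_adapted_vector`). The
`x i` form a basis (`exists_hilbertBasis`), so `φ 1 = 1`, and `a ⊗ a` again gives `φ (e i ⊗ e j) = x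
i ⊗ x j`. Traces against these recover every matrix entry of `φ A`. -/

theorem mul_rankOne (A : H →L[ℂ] H) (x y : H) :
    A * rankOne ℂ x y = rankOne ℂ (A x) y :=
  comp_rankOne x y A

theorem rankOne_mul_rankOne (x y z w : H) :
    rankOne ℂ x y * rankOne ℂ z w = inner ℂ y z • rankOne ℂ x w :=
  rankOne_comp_rankOne x y z w

/-- The trace of a rank-one operator is well defined. -/
theorem inner_eq_of_rankOne_eq {u v u' v' : H} {c : ℂ}
    (h : rankOne ℂ u v = c • rankOne ℂ u' v') : inner ℂ v u = c * inner ℂ v' u' := by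
  -- A rank-one `T` satisfies `T * T = tr(T) • T`, so squaring `h` compares the traces.
  have h2 : inner ℂ v u • rankOne ℂ u v = (c * inner ℂ v' u') • rankOne ℂ u v := by
    rw [← rankOne_mul_rankOne, h, smul_mul_smul_comm, rankOne_mul_rankOne, smul_smul, smul_smul]
    ring_nf
  by_cases h0 : rankOne ℂ u v = 0
  · have h1 : inner ℂ v u = 0 := by
      rcases rankOne_eq_zero.1 h0 with h | h <;> simp [h]
    rw [h0] at h
    rcases smul_eq_zero.1 h.symm with h | h
    · simp [h1, h]
    · rcases rankOne_eq_zero.1 h with h | h <;> simp [h1, h]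
  · exact smul_left_injective ℂ h0 h2

/-- If a rank-one operator `u ⊗ x` is a multiple `d` of a self-adjoint one and `d` is real,
then `u = d x`. -/
theorem eq_smul_of_rankOne_eq_smul_rankOne_self {u x w : H} {d : ℝ} (hx : ‖x‖ = 1) (hw : ‖w‖ = 1)
    (h : rankOne ℂ u x = (d : ℂ) • rankOne ℂ w w) : u = (d : ℂ) • x := by
  have ht : inner ℂ x u = (d : ℂ) := by
    rw [inner_eq_of_rankOne_eq h]
    simp [inner_self_eq_norm_sq_to_K, hw]
  have h' : rankOne ℂ u x = rankOne ℂ ((d : ℂ) • w) w := by simpa using h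
  have h'' : rankOne ℂ x u = (d : ℂ) • rankOne ℂ w w := by
    rw [rankOne_eq_rankOne_iff_comm.1 h', map_smulₛₗ, Complex.conj_ofReal]
  have h3 : rankOne ℂ u x = rankOne ℂ x u := h.trans h''.symm
  have h4 := congr($h3 x)
  rw [rankOne_apply, rankOne_apply, ← inner_conj_symm u x, ht] at h4
  simpa [inner_self_eq_norm_sq_to_K, hx] using h4

theorem HilbertBasis.countable_of_separableSpace [TopologicalSpace.SeparableSpace H] {ι : Type*}
    (e : HilbertBasis ι ℂ H) : Countable ι := by
  refine Pairwise.countable_of_isOpen_disjoint (s := fun i => Metric.ball (e i) (1 / 2)) ?_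
    (fun i => Metric.isOpen_ball) (fun i => Metric.nonempty_ball.2 (by norm_num))
  intro i j hij
  refine Metric.ball_disjoint_ball ?_
  have h1 : ‖e i - e j‖ ^ 2 = 2 := by
    rw [@norm_sub_sq ℂ, e.orthonormal.2 hij, e.orthonormal.1, e.orthonormal.1]
    norm_num
  rw [dist_eq_norm]
  nlinarith [norm_nonneg (e i - e j)]

theorem HilbertBasis.clm_ext {ι : Type*} (e : HilbertBasis ι ℂ H) {A B : H →L[ℂ] H}
    (h : ∀ i, A (e i) = B (e i)) : A = B := by
  refine ContinuousLinearMap.ext_on (s := Set.range e) ?_ ?_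
  · exact Submodule.dense_iff_topologicalClosure_eq_top.2 e.dense_span
  · rintro _ ⟨i, rfl⟩; exact h i

theorem HilbertBasis.ext_inner {ι : Type*} (e : HilbertBasis ι ℂ H) {x y : H}
    (h : ∀ i, inner ℂ (e i) x = inner ℂ (e i) y) : x = y := by
  apply e.repr.injective
  ext i
  rw [e.repr_apply_apply, e.repr_apply_apply, h]

theorem HilbertBasis.eq_smul_of_inner_eq_zero {ι : Type*} (e : HilbertBasis ι ℂ H) {x : H} {i : ι}
    (h : ∀ j, j ≠ i → inner ℂ (e j) x = 0) : x = inner ℂ (e i) x • e i := by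
  classical
  refine e.ext_inner fun j => ?_
  rw [inner_smul_right, orthonormal_iff_ite.1 e.orthonormal]
  by_cases hj : j = i
  · simp [hj]
  · simp [hj, h j hj]

/-- A vector all of whose coordinates are nonzero. -/
theorem HilbertBasis.exists_forall_inner_ne_zero [CompleteSpace H] {ι : Type*} [Countable ι]
    [Nonempty ι] (e : HilbertBasis ι ℂ H) : ∃ a : H, ‖a‖ = 1 ∧ ∀ i, inner ℂ (e i) a ≠ 0 := by
  classical
  obtain ⟨n, hn⟩ := exists_injective_nat ι
  have hs : Summable fun i => ((1 / 2 : ℂ) ^ n i) • e i := by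
    refine Summable.of_norm ?_
    refine (summable_geometric_two.comp_injective hn).congr fun i => ?_
    simp [norm_smul, e.orthonormal.1]
  set a := ∑' i, ((1 / 2 : ℂ) ^ n i) • e i with ha
  have hi : ∀ i, inner ℂ (e i) a = (1 / 2 : ℂ) ^ n i := by
    intro i
    rw [ha, ← innerSL_apply_apply ℂ, (innerSL ℂ (e i)).map_tsum hs, tsum_eq_single i]
    · simp [inner_self_eq_norm_sq_to_K, e.orthonormal.1]
    · intro j hj
      simp [e.orthonormal.2 hj.symm]
  have h0 : a ≠ 0 := by
    rintro h
    obtain ⟨i⟩ := ‹Nonempty ι›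
    have := hi i
    rw [h, inner_zero_right] at this
    exact pow_ne_zero _ (by norm_num) this.symm
  refine ⟨((‖a‖⁻¹ : ℝ) : ℂ) • a, ?_, fun i => ?_⟩
  · simp [norm_smul, norm_ne_zero_iff.2 h0]
  · rw [inner_smul_right, hi]
    exact mul_ne_zero (by simpa using h0) (pow_ne_zero _ (by norm_num))

/-- A diagonal operator with distinct real eigenvalues. -/
theorem HilbertBasis.exists_diagonal_injective [CompleteSpace H] {ι : Type*} [Countable ι]
    (e : HilbertBasis ι ℂ H) : ∃ (D : H →L[ℂ] H) (d : ι → ℝ), Function.Injective d ∧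
      ∀ i x, inner ℂ (e i) (D x) = d i * inner ℂ (e i) x := by
  classical
  obtain ⟨n, hn⟩ := exists_injective_nat ι
  have hs : Summable fun i => ((1 / 2 : ℂ) ^ n i) • rankOne ℂ (e i) (e i) := by
    refine Summable.of_norm ?_
    refine (summable_geometric_two.comp_injective hn).congr fun i => ?_
    simp [norm_smul, e.orthonormal.1]
  refine ⟨∑' i, ((1 / 2 : ℂ) ^ n i) • rankOne ℂ (e i) (e i), fun i => (1 / 2) ^ n i, ?_, ?_⟩
  · intro i j h
    exact hn (pow_right_injective₀ (by norm_num) (by norm_num) h)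
  · intro i x
    have hx := (((innerSL ℂ (e i)).comp (ContinuousLinearMap.apply ℂ H x)).map_tsum hs)
    simp only [ContinuousLinearMap.comp_apply, ContinuousLinearMap.apply_apply,
      innerSL_apply_apply] at hx
    rw [hx, tsum_eq_single i]
    · simp [inner_smul_right, inner_self_eq_norm_sq_to_K, e.orthonormal.1]
    · intro j hj
      simp [inner_smul_right, e.orthonormal.2 hj.symm]

end

/-! ### Maps multiplicative up to unitary conjugation. -/

section

variable {H : Type*} [NormedAddCommGroup H] [InnerProductSpace ℂ H] [CompleteSpace H]

theorem LinearIsometryEquiv.conjStarAlgEquiv_rankOne (U : H ≃ₗᵢ[ℂ] H) (x y : H) :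
    U.conjStarAlgEquiv (rankOne ℂ x y) = rankOne ℂ (U x) (U y) := by
  ext z
  simp [← U.inner_map_map y]

theorem StarAlgEquiv.exists_eq_conj (ψ : (H →L[ℂ] H) ≃⋆ₐ[ℂ] (H →L[ℂ] H)) :
    ∃ U : H ≃ₗᵢ[ℂ] H, ψ = U.conjStarAlgEquiv := by
  cases subsingleton_or_nontrivial H
  · exact ⟨.refl ℂ H, StarAlgEquiv.ext fun _ => Subsingleton.elim _ _⟩
  · exact ψ.eq_linearIsometryEquivConjStarAlgEquiv (StarAlgEquiv.isometry ψ).continuous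

/-- Products of values of `φ` are unitarily equivalent to the products of the arguments. -/
def IsLocallyMul (φ : (H →L[ℂ] H) → (H →L[ℂ] H)) : Prop :=
  ∀ A B : H →L[ℂ] H, ∃ U : H ≃ₗᵢ[ℂ] H, φ A * φ B = U.conjStarAlgEquiv (A * B)

namespace IsLocallyMul

variable {φ : (H →L[ℂ] H) → (H →L[ℂ] H)}

theorem map_one_mul_map_one (hφ : IsLocallyMul φ) : φ 1 * φ 1 = 1 := by
  obtain ⟨U, hU⟩ := hφ 1 1
  rw [hU, one_mul, map_one]

/-- Since `φ 1` is an involution, the image is `φ 1 x ⊗ x`. Its square must be a rank-one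
projection, which makes `x` an eigenvector of `φ 1`. -/
theorem exists_map_rankOne_self (hφ : IsLocallyMul φ) {e : H} (he : ‖e‖ = 1) :
    ∃ (x : H) (ε : ℂ), ‖x‖ = 1 ∧ (ε = 1 ∨ ε = -1) ∧
      φ (rankOne ℂ e e) = ε • rankOne ℂ x x ∧ φ 1 x = ε • x := by
  obtain ⟨U, hU⟩ := hφ 1 (rankOne ℂ e e)
  obtain ⟨V, hV⟩ := hφ (rankOne ℂ e e) (rankOne ℂ e e)
  rw [one_mul, U.conjStarAlgEquiv_rankOne] at hU
  have hx : ‖U e‖ = 1 := by rw [U.norm_map, he]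
  have hVe : ‖V e‖ = 1 := by rw [V.norm_map, he]
  set x := U e
  have hP : φ (rankOne ℂ e e) = rankOne ℂ (φ 1 x) x := by
    rw [← mul_rankOne, ← hU, ← mul_assoc, hφ.map_one_mul_map_one, one_mul]
  have hxx : inner ℂ x x = 1 := by simp [inner_self_eq_norm_sq_to_K, hx]
  have hee : inner ℂ e e = 1 := by simp [inner_self_eq_norm_sq_to_K, he]
  rw [hP, rankOne_mul_rankOne, rankOne_mul_rankOne, hee, one_smul,
    V.conjStarAlgEquiv_rankOne] at hV
  set c : ℂ := inner ℂ x (φ 1 x) with hc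
  have h1 : c • φ 1 x = x := by
    have := eq_smul_of_rankOne_eq_smul_rankOne_self (u := c • φ 1 x) (d := 1) hx hVe (by
      rw [Complex.ofReal_one, one_smul, ← hV, map_smul]
      rfl)
    simpa using this
  have hcc : c * c = 1 := by
    have := congr(inner ℂ x $h1)
    rwa [inner_smul_right, hxx] at this
  have h2 : φ 1 x = c • x := by
    nth_rw 2 [← h1]
    rw [smul_smul, hcc, one_smul]
  refine ⟨x, c, hx, mul_self_eq_one_iff.1 hcc, ?_, h2⟩
  rw [hP, h2]
  simp

/-- Both sides are traces of products of two rank-one operators. -/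
theorem inner_mul_inner_of_map_rankOne (hφ : IsLocallyMul φ) {u v u' v' p q p' q' : H} {ε ε' : ℂ}
    (h : φ (rankOne ℂ u v) = ε • rankOne ℂ p q) (h' : φ (rankOne ℂ u' v') = ε' • rankOne ℂ p' q') :
    ε * ε' * (inner ℂ q p' * inner ℂ q' p) = inner ℂ v u' * inner ℂ v' u := by
  obtain ⟨U, hU⟩ := hφ (rankOne ℂ u v) (rankOne ℂ u' v')
  rw [h, h', smul_mul_smul_comm, rankOne_mul_rankOne, rankOne_mul_rankOne, map_smul,
    U.conjStarAlgEquiv_rankOne, smul_smul] at hU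
  have := inner_eq_of_rankOne_eq (u := (ε * ε' * inner ℂ q p') • p) (v := q')
    (c := inner ℂ v u') (u' := U u) (v' := U v') (by simpa using hU)
  rw [U.inner_map_map, inner_smul_right] at this
  rw [← this]
  ring

theorem inner_map_apply_of_map_rankOne (hφ : IsLocallyMul φ) {u v p q : H}
    (h : φ (rankOne ℂ u v) = rankOne ℂ p q) (A : H →L[ℂ] H) :
    inner ℂ q (φ A p) = inner ℂ v (A u) := by
  obtain ⟨U, hU⟩ := hφ A (rankOne ℂ u v)
  rw [h, mul_rankOne, mul_rankOne, U.conjStarAlgEquiv_rankOne] at hU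
  have := inner_eq_of_rankOne_eq (c := 1) (hU.trans (one_smul ℂ _).symm)
  rwa [U.inner_map_map, one_mul] at this

/-- The images of the coordinate projections of a Hilbert basis, with phases adapted to a given
pair of vectors. -/
theorem exists_adapted_vector (hφ : IsLocallyMul φ) {e a b : H} (he : ‖e‖ = 1)
    (hea : inner ℂ e a ≠ 0) (hab : φ (rankOne ℂ a a) = rankOne ℂ b b) :
    ∃ x : H, ‖x‖ = 1 ∧ φ (rankOne ℂ e e) = rankOne ℂ x x ∧ φ 1 x = x ∧
      inner ℂ x b = inner ℂ e a := by
  obtain ⟨x, ε, hx, hε, hex, hSx⟩ := hφ.exists_map_rankOne_self he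
  have h := hφ.inner_mul_inner_of_map_rankOne (ε' := 1) hex (by rw [one_smul]; exact hab)
  rw [mul_one, ← inner_conj_symm b x, ← inner_conj_symm a e, Complex.mul_conj,
    Complex.mul_conj] at h
  have hpos := Complex.normSq_pos.2 hea
  have hnonneg := Complex.normSq_nonneg (inner ℂ x b)
  obtain rfl : ε = 1 := by
    refine hε.resolve_right ?_
    rintro rfl
    have h' : -Complex.normSq (inner ℂ x b) = Complex.normSq (inner ℂ e a) := by
      exact_mod_cast (neg_one_mul _).symm.trans h
    linarith
  have hnorm : ‖inner ℂ x b‖ = ‖inner ℂ e a‖ := by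
    rw [one_mul, Complex.ofReal_inj, Complex.normSq_eq_norm_sq, Complex.normSq_eq_norm_sq] at h
    exact (pow_left_inj₀ (norm_nonneg _) (norm_nonneg _) two_ne_zero).1 h
  set l : ℂ := inner ℂ x b / inner ℂ e a with hl
  have hl1 : ‖l‖ = 1 := by
    rw [hl, norm_div, hnorm, div_self (norm_ne_zero_iff.2 hea)]
  have hll : l * starRingEnd ℂ l = 1 := by
    rw [Complex.mul_conj, Complex.normSq_eq_norm_sq, hl1]; simp
  refine ⟨l • x, by rw [norm_smul, hl1, hx, one_mul], ?_, ?_, ?_⟩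
  · rw [hex, map_smulₛₗ (rankOne ℂ (l • x)), map_smul, smul_apply, smul_smul, mul_comm, hll]
  · rw [map_smul, hSx, one_smul]
  · have hxb : inner ℂ x b = l * inner ℂ e a := by rw [hl, div_mul_cancel₀ _ hea]
    rw [inner_smul_left, hxb, ← mul_assoc, mul_comm _ l, hll, one_mul]

theorem exists_hilbertBasis (hφ : IsLocallyMul φ) {ι : Type*} [Countable ι]
    (e : HilbertBasis ι ℂ H) (x : ι → H) (hx : ∀ i, ‖x i‖ = 1)
    (hex : ∀ i, φ (rankOne ℂ (e i) (e i)) = rankOne ℂ (x i) (x i)) (hS : ∀ i, φ 1 (x i) = x i) :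
    ∃ f : HilbertBasis ι ℂ H, ⇑f = x := by
  have hort : Orthonormal ℂ x := by
    refine ⟨hx, fun i j hij => ?_⟩
    have h := hφ.inner_mul_inner_of_map_rankOne (ε := 1) (ε' := 1)
      (by rw [one_smul]; exact hex i) (by rw [one_smul]; exact hex j)
    rw [e.orthonormal.2 hij, zero_mul, mul_one, one_mul, mul_eq_zero] at h
    rcases h with h | h
    · exact h
    · exact inner_eq_zero_symm.1 h
  -- Completeness: each `x i` is an eigenvector of `φ 1 * φ D = U D U*` for the simple eigenvalue `d
  -- i`, hence a multiple of `U (e i)`.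
  obtain ⟨D, d, hd, hD⟩ := e.exists_diagonal_injective
  have hDe : ∀ i, D (e i) = (d i : ℂ) • e i := by
    classical
    intro i
    refine e.ext_inner fun j => ?_
    rw [hD, inner_smul_right, orthonormal_iff_ite.1 e.orthonormal]
    split_ifs with h
    · rw [h]
    · simp
  have hφD : ∀ i, φ D (x i) = (d i : ℂ) • x i := by
    intro i
    obtain ⟨W, hW⟩ := hφ D (rankOne ℂ (e i) (e i))
    rw [hex, mul_rankOne, mul_rankOne, W.conjStarAlgEquiv_rankOne, hDe] at hW
    refine eq_smul_of_rankOne_eq_smul_rankOne_self (w := W (e i)) (hx i) ?_ ?_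
    · rw [W.norm_map, e.orthonormal.1]
    · rw [hW, map_smul, map_smul]; rfl
  obtain ⟨U, hU⟩ := hφ 1 D
  rw [one_mul] at hU
  have hxU : ∀ i, ∃ c : ℂ, x i = c • U (e i) := by
    intro i
    have h1 := congr($hU (x i))
    rw [mul_apply_eq_comp, hφD, map_smul, hS,
      LinearIsometryEquiv.conjStarAlgEquiv_apply_apply] at h1
    have h2 : D (U.symm (x i)) = (d i : ℂ) • U.symm (x i) := by
      apply U.injective
      rw [← h1, map_smul, U.apply_symm_apply]
    refine ⟨inner ℂ (e i) (U.symm (x i)), ?_⟩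
    rw [← map_smul, ← e.eq_smul_of_inner_eq_zero, U.apply_symm_apply]
    intro j hj
    have h3 := hD j (U.symm (x i))
    rw [h2, inner_smul_right] at h3
    by_contra h0
    exact hj (hd (by exact_mod_cast (mul_right_cancel₀ h0 h3).symm))
  refine ⟨HilbertBasis.mkOfOrthogonalEqBot hort ?_, HilbertBasis.coe_mkOfOrthogonalEqBot _ _⟩
  rw [eq_bot_iff]
  intro z hz
  rw [Submodule.mem_bot]
  suffices U.symm z = 0 by simpa using this
  refine e.ext_inner fun i => ?_
  obtain ⟨c, hc⟩ := hxU i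
  have h1 : inner ℂ (x i) z = 0 := hz _ (Submodule.subset_span ⟨i, rfl⟩)
  have hc0 : c ≠ 0 := by
    rintro rfl
    have := hx i
    rw [hc] at this
    simp at this
  rw [hc, inner_smul_left, mul_eq_zero] at h1
  rw [inner_zero_right, ← U.inner_map_map, U.apply_symm_apply]
  exact h1.resolve_left (by simpa using hc0)

theorem exists_map_eq_conj (hφ : IsLocallyMul φ) {ι : Type*} [Countable ι]
    (e : HilbertBasis ι ℂ H) {a b : H} (ha : ∀ i, inner ℂ (e i) a ≠ 0)
    (hab : φ (rankOne ℂ a a) = rankOne ℂ b b) :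
    ∃ U : H ≃ₗᵢ[ℂ] H, ∀ A, φ A = U.conjStarAlgEquiv A := by
  choose x hx hex hS hxb using fun i =>
    hφ.exists_adapted_vector (e.orthonormal.1 i) (ha i) hab
  obtain ⟨f, hf⟩ := hφ.exists_hilbertBasis e x hx hex hS
  have hone : φ 1 = 1 := f.clm_ext fun i => by simp [hf, hS]
  have hunit : ∀ i j, ∃ c : ℂ,
      φ (rankOne ℂ (e i) (e j)) = rankOne ℂ (c • f i) (f j) := by
    intro i j
    obtain ⟨W, hW⟩ := hφ 1 (rankOne ℂ (e i) (e j))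
    rw [hone, one_mul, one_mul, W.conjStarAlgEquiv_rankOne] at hW
    have hx0 : ∀ k, x k ≠ 0 := fun k => norm_ne_zero_iff.1 (by simp [hx])
    have hW0 : ∀ k, W (e k) ≠ 0 := fun k =>
      norm_ne_zero_iff.1 (by rw [W.norm_map, e.orthonormal.1]; exact one_ne_zero)
    -- Multiplying by the other coordinate projections gives zero, which confines the range to `f
    -- i`; `hv` does the same on the right.
    have hu : ∀ k, k ≠ i → inner ℂ (f k) (W (e i)) = 0 := by
      intro k hk
      obtain ⟨V, hV⟩ := hφ (rankOne ℂ (e k) (e k)) (rankOne ℂ (e i) (e j))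
      rw [hW, hex, rankOne_mul_rankOne, rankOne_mul_rankOne, e.orthonormal.2 hk, zero_smul,
        map_zero, smul_eq_zero, rankOne_eq_zero] at hV
      rw [hf]
      exact hV.resolve_right (not_or.2 ⟨hx0 k, hW0 j⟩)
    have hv : ∀ k, k ≠ j → inner ℂ (f k) (W (e j)) = 0 := by
      intro k hk
      obtain ⟨V, hV⟩ := hφ (rankOne ℂ (e i) (e j)) (rankOne ℂ (e k) (e k))
      rw [hW, hex, rankOne_mul_rankOne, rankOne_mul_rankOne, e.orthonormal.2 hk.symm, zero_smul,
        map_zero, smul_eq_zero, rankOne_eq_zero] at hV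
      rw [hf]
      exact inner_eq_zero_symm.1 (hV.resolve_right (not_or.2 ⟨hW0 i, hx0 k⟩))
    rw [hW, f.eq_smul_of_inner_eq_zero hu, f.eq_smul_of_inner_eq_zero hv]
    refine ⟨starRingEnd ℂ (inner ℂ (f j) (W (e j))) * inner ℂ (f i) (W (e i)), ?_⟩
    ext z
    simp [smul_smul]
    ring_nf
  have hentry : ∀ A i j, inner ℂ (f j) (φ A (f i)) = inner ℂ (e j) (A (e i)) := by
    intro A i j
    obtain ⟨c, hc⟩ := hunit i j
    -- All coordinates of `a` are nonzero and agree with those of `b`, so this entry forces `c = 1`.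
    have h1 := hφ.inner_map_apply_of_map_rankOne hc (rankOne ℂ a a)
    have h2 := hφ.inner_map_apply_of_map_rankOne hc A
    have hia : inner ℂ b (f i) = inner ℂ a (e i) := by
      rw [← inner_conj_symm, hf, hxb, inner_conj_symm]
    have hia0 : inner ℂ a (e i) ≠ 0 := fun h => ha i (inner_eq_zero_symm.1 h)
    rw [hab, map_smul, rankOne_apply, rankOne_apply, inner_smul_right, inner_smul_right,
      inner_smul_right, hia, hf, hxb] at h1
    have hc1 : c = 1 := mul_right_cancel₀ (mul_ne_zero hia0 (ha j)) (by rw [h1, one_mul])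
    rwa [hc1, one_smul] at h2
  refine ⟨e.repr.trans f.repr.symm, fun A => f.clm_ext fun i => f.ext_inner fun j => ?_⟩
  have hUe : ∀ i, (e.repr.trans f.repr.symm) (e i) = f i := by
    classical
    intro i
    rw [LinearIsometryEquiv.trans_apply, e.repr_self, f.repr_symm_single]
  rw [hentry, LinearIsometryEquiv.conjStarAlgEquiv_apply_apply, ← hUe i, ← hUe j,
    LinearIsometryEquiv.symm_apply_apply, LinearIsometryEquiv.inner_map_map]

theorem neg (hφ : IsLocallyMul φ) : IsLocallyMul fun A => -φ A := by
  intro A B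
  simpa using hφ A B

end IsLocallyMul

end

theorem theorem2 {H : Type*} [NormedAddCommGroup H] [InnerProductSpace ℂ H] [CompleteSpace H]
    [TopologicalSpace.SeparableSpace H] (φ : (H →L[ℂ] H) → (H →L[ℂ] H))
    (hφ : ∀ A B : H →L[ℂ] H, ∃ ψ : (H →L[ℂ] H) ≃⋆ₐ[ℂ] (H →L[ℂ] H), φ A * φ B = ψ (A * B)) :
    (∃ ψ : (H →L[ℂ] H) ≃⋆ₐ[ℂ] (H →L[ℂ] H), ∀ A : H →L[ℂ] H, φ A = ψ A) ∨
      (∃ ψ : (H →L[ℂ] H) ≃⋆ₐ[ℂ] (H →L[ℂ] H), ∀ A : H →L[ℂ] H, φ A = -ψ A) := by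
  cases subsingleton_or_nontrivial H
  · exact Or.inl ⟨.refl _ _, fun _ => Subsingleton.elim _ _⟩
  have hloc : IsLocallyMul φ := by
    intro A B
    obtain ⟨ψ, hψ⟩ := hφ A B
    obtain ⟨U, rfl⟩ := ψ.exists_eq_conj
    exact ⟨U, hψ⟩
  obtain ⟨w, e, -⟩ := _root_.exists_hilbertBasis ℂ H
  have := e.countable_of_separableSpace
  have : Nonempty w := by
    by_contra h
    rw [not_nonempty_iff] at h
    obtain ⟨x, hx⟩ := exists_ne (0 : H)
    exact hx (e.ext_inner fun i => h.elim i)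
  obtain ⟨a, ha, hea⟩ := e.exists_forall_inner_ne_zero
  obtain ⟨b, ε, -, rfl | rfl, hab, -⟩ := hloc.exists_map_rankOne_self ha
  · obtain ⟨U, hU⟩ := hloc.exists_map_eq_conj e hea (by rw [hab, one_smul])
    exact Or.inl ⟨_, hU⟩
  · obtain ⟨U, hU⟩ := hloc.neg.exists_map_eq_conj e hea (b := b) (by simp [hab])
    exact Or.inr ⟨_, fun A => by rw [← hU, neg_neg]⟩
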